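/- Let $m\ge 0$, let $\mathcal H=\mathbb C^{d_1}\otimes\cdots\otimes\mathbb C^{d_m}$ be the state space of $m$ parties, and let $U_1,U_2$ be unitary operators on $\mathcal H$. The local numerical range of a linear operator $A$ on $\mathcal H$ is $$W^{local}(A)=\{\langle\psi|A|\psi\rangle : |\psi\rangle=|\psi_1\rangle\otimes\cdots\otimes|\psi_m\rangle,\ |\psi_k\rangle\in\mathbb C^{d_k},\ \langle\psi_k|\psi_k\rangle=1\}.$$ Say that $U_1$ and $U_2$ are perfectly distinguishable by LOCC in a single run if there are finite-dimensional auxiliary spaces $\mathcal H_k'$ (one for each party), unit vectors $|\varphi_k\rangle\in\mathbb C^{d_k}\otimes\mathcal H_k'$, and a protocol that starts in the product state $|\varphi_1\rangle\otimes\cdots\otimes|\varphi_m\rangle$, consists of finitely many steps, and ends with a guess, such that the following holds: each step is either a local measurement (given by finitely many Kraus operators, in particular possibly a local unitary operation) by one party on its space $\mathbb C^{d_k}\otimes\mathcal H_k'$, whose outcome is announced to all parties and on which all later steps and the guess may depend, or an application of the unknown operation $U\otimes I$, with $U\in\{U_1,U_2\}$ and $I$ the identity on $\bigotimes_k\mathcal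 H_k'$, which occurs exactly once along every branch of the protocol; and for both $U=U_1$ and $U=U_2$ the guess is correct with probability $1$. **Theorem 1.** $U_1$ and $U_2$ are perfectly distinguishable by LOCC in a single run if and only if $0\in W^{local}(U_1^\dagger U_2)$. In particular, local ancillary entanglement gives no advantage: $U_1$ and $U_2$ are perfectly distinguishable by LOCC in a single run if and only if this is possible without auxiliary systems, that is, with a product of unit vectors $|\varphi_k\rangle\in\mathbb C^{d_k}$ as input, and with local unitary operations and local projective measurements on the spaces $\mathbb C^{d_k}$ as the only local steps. -/

import Mathlib

open scoped Matrix

/-!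
A multipartite quantum system is described in coordinates: party `k` has the state space `ℂ^(n k)`
for a finite index type `n k`, and the tensor product of these spaces is the space of
functions on `(k : ι) → n k`, whose points label the product basis.
-/

namespace LOCC

noncomputable section

section Basic

variable {ι : Type} [Fintype ι] [DecidableEq ι]
variable {n : ι → Type} [∀ k, Fintype (n k)] [∀ k, DecidableEq (n k)]

/-- The vector `ψ` is a (normalized) pure state: `⟨ψ|ψ⟩ = 1`. -/
def IsState {α : Type} [Fintype α] (ψ : α → ℂ) : Prop :=
  star ψ ⬝ᵥ ψ = 1

/-- The product vector `⨂ₖ |ψₖ⟩`. -/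
def productVec (ψ : ∀ k, n k → ℂ) : (∀ k, n k) → ℂ :=
  fun i => ∏ k, ψ k (i k)

/-- The local numerical range: all values `⟨ψ|A|ψ⟩` with `|ψ⟩ = ⨂ₖ |ψₖ⟩` a product of states. -/
def localNumericalRange (A : Matrix (∀ k, n k) (∀ k, n k) ℂ) : Set ℂ :=
  {z | ∃ ψ : ∀ k, n k → ℂ, (∀ k, IsState (ψ k)) ∧
    z = star (productVec ψ) ⬝ᵥ (A *ᵥ productVec ψ)}

/-- The operator that acts as `K` on the system of party `k` and as the identity on all other
parties. -/
def onParty (k : ι) (K : Matrix (n k) (n k) ℂ) : Matrix (∀ k, n k) (∀ k, n k) ℂ :=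
  Matrix.of fun i j => if ∀ l, l ≠ k → i l = j l then K (i k) (j k) else 0

/-- The operator `A ⊗ I`, where party `k` holds an additional auxiliary system with index type
`a k` and the identity acts on all auxiliary systems. The system of party `k` is then
`ℂ^(n k) ⊗ ℂ^(a k) = ℂ^(n k × a k)`. -/
def withAncilla (a : ι → Type) [∀ k, DecidableEq (a k)]
    (A : Matrix (∀ k, n k) (∀ k, n k) ℂ) :
    Matrix (∀ k, n k × a k) (∀ k, n k × a k) ℂ :=
  Matrix.of fun i j =>
    if ∀ k, (i k).2 = (j k).2 then A (fun k => (i k).1) (fun k => (j k).1) else 0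

variable (n) in
/-- An LOCC protocol, with a finite number of rounds, that uses a black-box operation on the
joint system exactly `N` times along every branch and ends with a guess (`false` or `true`).
In a `measure` step one party `k` performs a local quantum measurement with Kraus operators
`K s`, broadcasts the outcome `s`, and everything that follows may depend on it. (A local unitary
operation is a measurement with a single outcome.) -/
inductive Protocol : ℕ → Type
  | guess (b : Bool) : Protocol 0
  | measure {N : ℕ} (k : ι) (r : ℕ) (K : Fin r → Matrix (n k) (n k) ℂ)
      (complete : ∑ s, (K s)ᴴ * K s = 1) (next : Fin r → Protocol N) : Protocol N
  | run {N : ℕ} (next : Protocol N) : Protocol (N + 1)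

/-- The probability that the protocol ends with the guess `c`, if the black box is `V` and
the joint system starts in the pure state `ψ`. In the recursion `ψ` is the unnormalized state of
the current branch, whose squared norm is the probability of the branch. -/
def Protocol.prob (V : Matrix (∀ k, n k) (∀ k, n k) ℂ) (c : Bool) :
    {N : ℕ} → Protocol n N → ((∀ k, n k) → ℂ) → ℝ
  | _, .guess b, ψ => if b = c then ∑ i, ‖ψ i‖ ^ 2 else 0
  | _, .measure k _ K _ next, ψ => ∑ s, (next s).prob V c (onParty k (K s) *ᵥ ψ)
  | _, .run next, ψ => next.prob V c (V *ᵥ ψ)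

/-- Every local step of the protocol is a unitary operation (a single outcome `s`, where
completeness says `(K s)ᴴ * K s = 1`) or a projective measurement. -/
def Protocol.IsProjective : {N : ℕ} → Protocol n N → Prop
  | _, .guess _ => True
  | _, .measure _ r K _ next => (r = 1 ∨ ∀ s, IsStarProjection (K s)) ∧ ∀ s, (next s).IsProjective
  | _, .run next => next.IsProjective

/-- Started in the state `ψ`, the protocol guesses with certainty which of `V₁` (`false`) and
`V₂` (`true`) is the black box. -/
def Protocol.Identifies {N : ℕ} (P : Protocol n N) (ψ : (∀ k, n k) → ℂ)
    (V₁ V₂ : Matrix (∀ k, n k) (∀ k, n k) ℂ) : Prop :=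
  P.prob V₁ false ψ = 1 ∧ P.prob V₂ true ψ = 1

end Basic

section Distinguishability

variable {m : ℕ} {d : Fin m → ℕ}

/-- `U₁` and `U₂` are perfectly distinguishable by LOCC with `N` runs: for some finite-dimensional
auxiliary systems, some product (across the parties) of pure states, each of which may be entangled
between the system and the auxiliary system of one party, and some LOCC protocol with `N` runs of
the unknown operation, the operation is identified with certainty. -/
def Distinguishable (N : ℕ) (U₁ U₂ : Matrix (∀ k, Fin (d k)) (∀ k, Fin (d k)) ℂ) : Prop :=
  ∃ (a : Fin m → ℕ) (φ : ∀ k, Fin (d k) × Fin (a k) → ℂ)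
    (P : Protocol (fun k => Fin (d k) × Fin (a k)) N),
    (∀ k, IsState (φ k)) ∧
      P.Identifies (productVec φ) (withAncilla (fun k => Fin (a k)) U₁)
        (withAncilla (fun k => Fin (a k)) U₂)

/-- The same without auxiliary systems: the input is a product state of the original systems, and
the parties use only local unitary operations and local projective measurements on these systems. -/
def DistinguishableWithoutAncilla (N : ℕ)
    (U₁ U₂ : Matrix (∀ k, Fin (d k)) (∀ k, Fin (d k)) ℂ) : Prop :=
  ∃ (φ : ∀ k, Fin (d k) → ℂ) (P : Protocol (fun k => Fin (d k)) N),
    (∀ k, IsState (φ k)) ∧ P.IsProjective ∧ P.Identifies (productVec φ) U₁ U₂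

end Distinguishability

end

end LOCC

/-! Necessity: local Kraus operators applied before the run keep product vectors product, and every
branch of nonzero probability must still succeed with certainty. After the run, completeness splits
the inner product of the two candidate states over the branches, and in each branch a certain guess
forces one of the two vectors to vanish. Hence V₁χ ⊥ V₂χ for some nonzero product vector χ
(`Protocol.exists_productVec_orthogonal`).

With auxiliary systems, ⟨χ|A ⊗ I|χ⟩ is the expectation of A in the product of the reduced states. It
is linear in each of them, so Toeplitz–Hausdorff (`exists_apply_self_eq_sum`) replaces the mixed
states by pure ones, one party at a time, without changing the value 0.

Sufficiency: a product state with expectation 0 is mapped to two orthogonal states. A matrix of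
trace zero has zero diagonal in some orthonormal basis (again by Toeplitz–Hausdorff), so each party
in turn can measure in a basis for which every outcome leaves the two states orthogonal. Once all
have measured, the two vectors are parallel as well, so one is zero and the guess is certain
(`exists_protocol_of_orthogonal`). -/

namespace LOCC

/-! ### Toeplitz–Hausdorff for sesquilinear forms -/

section QuadraticForm

variable {E : Type*} [AddCommGroup E] [Module ℂ E]

/-- For every sesquilinear form on `ℂ²` with diagonal `(a, b)` and off-diagonal part `(c₁, c₂)` there
is a nonzero vector where it takes the value `a + b`: the form is constant along a line through the
centre of the Bloch ball. -/
theorem exists_amplitudes (a b c₁ c₂ : ℂ) : ∃ α β : ℂ, (α ≠ 0 ∨ β ≠ 0) ∧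
    star α * α * a + star β * β * b + star α * β * c₁ + star β * α * c₂ = a + b := by
  set z := a - b with hab
  -- If |α|² = 1 + h, |β|² = 1 - h and ᾱβ = g, the form takes the value a + b + f (h, g). The kernel
  -- of f is nonzero because it maps three real dimensions to two.
  let f : ℝ × ℂ →ₗ[ℝ] ℂ :=
    { toFun := fun p => p.1 * z + p.2 * c₁ + star p.2 * c₂
      map_add' := by
        rintro ⟨h, g⟩ ⟨h', g'⟩
        simp only [Prod.mk_add_mk, Complex.ofReal_add, star_add]
        ring
      map_smul' := by
        rintro r ⟨h, g⟩
        simp only [Prod.smul_mk, smul_eq_mul, Complex.real_smul, Complex.ofReal_mul, star_mul',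
          RingHom.id_apply, Complex.star_def, Complex.conj_ofReal]
        ring }
  have hker : LinearMap.ker f ≠ ⊥ := by
    apply LinearMap.ker_ne_bot_of_finrank_lt
    simp [Module.finrank_prod, Complex.finrank_real_complex]
  obtain ⟨⟨h₀, g₀⟩, hf, hne⟩ := Submodule.exists_mem_ne_zero_of_ne_bot hker
  set R : ℝ := h₀ ^ 2 + Complex.normSq g₀ with hR
  have hRpos : 0 < R := by
    rcases eq_or_ne h₀ 0 with h0 | h0
    · have hg : g₀ ≠ 0 := by
        rintro rfl
        exact hne (by simp [h0])
      have := Complex.normSq_pos.2 hg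
      positivity
    · have := Complex.normSq_nonneg g₀
      positivity
  obtain ⟨h, g, hfg, hnorm⟩ : ∃ (h : ℝ) (g : ℂ), h * z + g * c₁ + star g * c₂ = 0 ∧
      h ^ 2 + Complex.normSq g = 1 := by
    have hs : (Real.sqrt R)⁻¹ ^ 2 = R⁻¹ := by
      rw [inv_pow, Real.sq_sqrt hRpos.le]
    refine ⟨(Real.sqrt R)⁻¹ * h₀, ((Real.sqrt R)⁻¹ : ℝ) * g₀, ?_, ?_⟩
    · have hf' : f ((Real.sqrt R)⁻¹ • (h₀, g₀)) = 0 := by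
        rw [map_smul, LinearMap.mem_ker.1 hf, smul_zero]
      simpa [f] using hf'
    · rw [map_mul, Complex.normSq_ofReal, mul_pow, ← pow_two, ← mul_add, hs, ← hR]
      exact inv_mul_cancel₀ hRpos.ne'
  have hgg : star g * g = 1 - (h : ℂ) ^ 2 := by
    rw [Complex.star_def, ← Complex.normSq_eq_conj_mul_self]
    rw [eq_sub_iff_add_eq', ← Complex.ofReal_pow, ← Complex.ofReal_add, hnorm, Complex.ofReal_one]
  have hgn := Complex.normSq_nonneg g
  rcases eq_or_ne (1 + h) 0 with hh | hh
  -- The south pole of the Bloch sphere, where α = 0 and g / α makes no sense.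
  · have hh' : h = -1 := by linarith
    subst hh'
    have hg : g = 0 := by
      rw [← Complex.normSq_eq_zero]
      linarith
    subst hg
    have hz : z = 0 := by simpa using hfg
    refine ⟨0, (Real.sqrt 2 : ℝ), Or.inr (by simp), ?_⟩
    have h2 : (Real.sqrt 2 : ℂ) * (Real.sqrt 2 : ℂ) = 2 := by
      rw [← Complex.ofReal_mul, Real.mul_self_sqrt (by norm_num)]
      norm_num
    have hab' : a = b := sub_eq_zero.1 (hab.symm.trans hz)
    simp only [star_zero, zero_mul, mul_zero, zero_add, add_zero, Complex.star_def,
      Complex.conj_ofReal, h2, hab']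
    ring
  · have hpos : 0 < 1 + h := lt_of_le_of_ne (by nlinarith) hh.symm
    set x : ℝ := Real.sqrt (1 + h) with hx
    have hxx : (x : ℂ) * x = 1 + h := by
      rw [← Complex.ofReal_mul, hx, Real.mul_self_sqrt hpos.le]
      push_cast
      ring
    have hx0 : (x : ℂ) ≠ 0 := by
      exact_mod_cast (Real.sqrt_pos.2 hpos).ne'
    have hc : (1 + h : ℂ) ≠ 0 := by
      exact_mod_cast hh
    refine ⟨x, g / x, Or.inl hx0, ?_⟩
    have e1 : star (x : ℂ) = x := by simp
    have e2 : star (g / x : ℂ) = star g / x := by simp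
    have e3 : star g / x * (g / x) = 1 - h := by
      rw [div_mul_div_comm, hgg, hxx]
      field_simp
      ring
    rw [e1, e2, e3, hxx, mul_div_cancel₀ _ hx0, div_mul_cancel₀ _ hx0]
    rw [hab] at hfg
    linear_combination hfg

/-- The values of a sesquilinear form on the diagonal are closed under addition, in a way that
keeps track of nonzero vectors (the Toeplitz–Hausdorff theorem for cones). -/
theorem exists_apply_self_eq_add (B : E →ₗ⋆[ℂ] E →ₗ[ℂ] ℂ) (S : Submodule ℂ E) {v w : E}
    (hv : v ∈ S) (hw : w ∈ S) :
    ∃ u ∈ S, B u u = B v v + B w w ∧ (u = 0 → v = 0 ∧ w = 0) := by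
  by_cases hv0 : v = 0
  · exact ⟨w, hw, by simp [hv0], fun h => ⟨hv0, h⟩⟩
  -- For parallel vectors a combination with nonzero coefficients may vanish, so v is rescaled
  -- instead, by √(1 + |c|²).
  by_cases hd : ∃ c : ℂ, w = c • v
  · obtain ⟨c, rfl⟩ := hd
    have hpos : 0 < 1 + Complex.normSq c := by
      have := Complex.normSq_nonneg c
      positivity
    have hss : (Real.sqrt (1 + Complex.normSq c) : ℂ) * Real.sqrt (1 + Complex.normSq c) =
        1 + star c * c := by
      rw [← Complex.ofReal_mul, Real.mul_self_sqrt hpos.le, Complex.star_def,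
        ← Complex.normSq_eq_conj_mul_self]
      push_cast
      ring
    refine ⟨(Real.sqrt (1 + Complex.normSq c) : ℂ) • v, S.smul_mem _ hv, ?_, fun h => ?_⟩
    · simp only [LinearMap.map_smulₛₗ, LinearMap.smul_apply, map_smul, smul_eq_mul,
        Complex.conj_ofReal]
      rw [← mul_assoc, hss, Complex.star_def]
      ring
    · rcases smul_eq_zero.1 h with h | h
      · exact absurd (Complex.ofReal_eq_zero.1 h) (Real.sqrt_pos.2 hpos).ne'
      · exact absurd h hv0
  obtain ⟨α, β, hne, hαβ⟩ := exists_amplitudes (B v v) (B w w) (B v w) (B w v)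
  refine ⟨α • v + β • w, S.add_mem (S.smul_mem _ hv) (S.smul_mem _ hw), ?_, fun h => ?_⟩
  · rw [← hαβ]
    simp only [LinearMap.add_apply, LinearMap.map_smulₛₗ, LinearMap.smul_apply,
      map_smul, map_add, smul_eq_mul, Complex.star_def]
    ring
  · exfalso
    by_cases hβ : β = 0
    · subst hβ
      have hα : α ≠ 0 := by simpa using hne
      rw [zero_smul, add_zero] at h
      exact (smul_eq_zero.1 h).elim hα hv0
    · refine hd ⟨-(β⁻¹ * α), ?_⟩
      have h' : β • w = -(α • v) := (neg_eq_of_add_eq_zero_right h).symm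
      rw [neg_smul, mul_smul, ← smul_neg, ← h', inv_smul_smul₀ hβ]

/-- The final clause makes u nonzero, hence normalizable. Taking S to be an orthogonal complement
serves the construction of bases; S = ⊤ serves the replacement of mixed states by pure ones. -/
theorem exists_apply_self_eq_sum (B : E →ₗ⋆[ℂ] E →ₗ[ℂ] ℂ) (S : Submodule ℂ E) {κ : Type*}
    (s : Finset κ) (v : κ → E) (hv : ∀ i ∈ s, v i ∈ S) :
    ∃ u ∈ S, B u u = ∑ i ∈ s, B (v i) (v i) ∧ (u = 0 → ∀ i ∈ s, v i = 0) := by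
  classical
  induction s using Finset.induction_on with
  | empty => exact ⟨0, S.zero_mem, by simp, by simp⟩
  | insert i s hi ih =>
    obtain ⟨u, hu, hB, h0⟩ := ih fun j hj => hv j (Finset.mem_insert_of_mem hj)
    obtain ⟨u', hu', hB', h0'⟩ :=
      exists_apply_self_eq_add B S (hv i (Finset.mem_insert_self _ _)) hu
    refine ⟨u', hu', by rw [hB', hB, Finset.sum_insert hi], fun h j hj => ?_⟩
    rcases Finset.mem_insert.1 hj with rfl | hj
    · exact (h0' h).1
    · exact h0 (h0' h).2 j hj

end QuadraticForm

/-! ### Orthonormal bases with zero diagonal -/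

section Ketbra

variable {α : Type}

/-- The sesquilinear form `(v, w) ↦ L |w⟩⟨v|` of a linear functional `L` on matrices. -/
def ketbraForm (L : Matrix α α ℂ →ₗ[ℂ] ℂ) : (α → ℂ) →ₗ⋆[ℂ] (α → ℂ) →ₗ[ℂ] ℂ :=
  LinearMap.mk₂'ₛₗ _ _ (fun v w => L (Matrix.vecMulVec w (star v)))
    (fun v v' w => by rw [star_add, Matrix.vecMulVec_add, map_add])
    (fun c v w => by simp [star_smul, Matrix.vecMulVec_smul, map_smul])
    (fun v w w' => by rw [Matrix.add_vecMulVec, map_add])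
    (fun c v w => by simp [Matrix.smul_vecMulVec, map_smul])

theorem ketbraForm_apply (L : Matrix α α ℂ →ₗ[ℂ] ℂ) (v w : α → ℂ) :
    ketbraForm L v w = L (Matrix.vecMulVec w (star v)) := rfl

variable [Fintype α] [DecidableEq α]

theorem sum_ketbra_orthonormalBasis {κ : Type*} [Fintype κ]
    (b : OrthonormalBasis κ ℂ (EuclideanSpace ℂ α)) :
    ∑ i, Matrix.vecMulVec (b i).ofLp (star (b i).ofLp) = 1 := by
  ext x y
  -- Column y of the completeness relation is the expansion of the y-th standard basis vector.
  have h := b.sum_repr' (EuclideanSpace.single y (1 : ℂ))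
  have h' := congrArg (fun v : EuclideanSpace ℂ α => v x) h
  simp only [EuclideanSpace.inner_single_right, WithLp.ofLp_sum, WithLp.ofLp_smul,
    Finset.sum_apply, Pi.smul_apply, smul_eq_mul, PiLp.single_apply, one_mul] at h'
  rw [Matrix.sum_apply, Matrix.one_apply, ← h']
  refine Finset.sum_congr rfl fun i _ => ?_
  simp [Matrix.vecMulVec_apply, mul_comm]

/-- A linear functional that vanishes on the identity vanishes on the projections onto the vectors
of some orthonormal basis. -/
theorem exists_orthonormalBasis_apply_ketbra_eq_zero (L : Matrix α α ℂ →ₗ[ℂ] ℂ) (hL : L 1 = 0) :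
    ∃ b : OrthonormalBasis α ℂ (EuclideanSpace ℂ α),
      ∀ i, L (Matrix.vecMulVec (b i).ofLp (star (b i).ofLp)) = 0 := by
  suffices H : ∀ s : Finset α, ∃ b : OrthonormalBasis α ℂ (EuclideanSpace ℂ α),
      ∀ i ∈ s, L (Matrix.vecMulVec (b i).ofLp (star (b i).ofLp)) = 0 by
    obtain ⟨b, hb⟩ := H Finset.univ
    exact ⟨b, fun i => hb i (Finset.mem_univ i)⟩
  intro s
  induction s using Finset.induction_on with
  | empty => exact ⟨EuclideanSpace.basisFun α ℂ, by simp⟩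
  | insert i₀ s hi₀ ih =>
    obtain ⟨b, hb⟩ := ih
    let S : Submodule ℂ (EuclideanSpace ℂ α) := (Submodule.span ℂ (b '' s))ᗮ
    have hS : ∀ i ∈ sᶜ, b i ∈ S := by
      intro i hi
      rw [Submodule.mem_orthogonal]
      intro u hu
      induction hu using Submodule.span_induction with
      | mem x hx =>
        obtain ⟨j, hj, rfl⟩ := hx
        rw [b.inner_eq_ite, if_neg]
        rintro rfl
        exact Finset.mem_compl.1 hi hj
      | zero => simp
      | add x y _ _ hx hy => rw [inner_add_left, hx, hy, add_zero]
      | smul c x _ hx => rw [inner_smul_left, hx, mul_zero]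
    let B : EuclideanSpace ℂ α →ₗ⋆[ℂ] EuclideanSpace ℂ α →ₗ[ℂ] ℂ :=
      ((ketbraForm L).comp (WithLp.linearEquiv 2 ℂ (α → ℂ)).toLinearMap).compl₂
        (WithLp.linearEquiv 2 ℂ (α → ℂ)).toLinearMap
    have hBapp : ∀ v, B v v = L (Matrix.vecMulVec v.ofLp (star v.ofLp)) := fun v => rfl
    obtain ⟨u, huS, hu, hu0⟩ := exists_apply_self_eq_sum B S sᶜ b hS
    -- The full sum is L 1 = 0 and the terms in s already vanish, so the remaining values can be
    -- merged into one vector orthogonal to those already chosen.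
    have hsum : ∑ i ∈ sᶜ, B (b i) (b i) = 0 := by
      have h1 : ∑ i, B (b i) (b i) = 0 := by
        simp only [hBapp]
        rw [← map_sum, sum_ketbra_orthonormalBasis, hL]
      rw [← Finset.sum_add_sum_compl s, Finset.sum_eq_zero, zero_add] at h1
      · exact h1
      · intro i hi
        rw [hBapp, hb i hi]
    rw [hsum] at hu
    have hune : u ≠ 0 := fun h =>
      b.orthonormal.ne_zero i₀ (hu0 h i₀ (Finset.mem_compl.2 hi₀))
    let u' : EuclideanSpace ℂ α := ((‖u‖⁻¹ : ℝ) : ℂ) • u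
    have hu'norm : ‖u'‖ = 1 := by
      rw [norm_smul, Complex.norm_real, norm_inv, norm_norm, inv_mul_cancel₀ (norm_ne_zero_iff.2 hune)]
    have hu'S : u' ∈ S := S.smul_mem _ huS
    have hu'B : B u' u' = 0 := by
      simp only [u', LinearMap.map_smulₛₗ, LinearMap.smul_apply, hu, smul_zero]
    have hperp : ∀ i ∈ s, inner ℂ (b i) u' = 0 := fun i hi =>
      (Submodule.mem_orthogonal _ _).1 hu'S _ (Submodule.subset_span ⟨i, hi, rfl⟩)
    have hne : ∀ i ∈ s, i ≠ i₀ := fun i hi h => hi₀ (h ▸ hi)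
    -- Only the vectors indexed by `insert i₀ s` are kept; the rest of the basis is chosen anew.
    have hon : Orthonormal ℂ
        (((insert i₀ s : Finset α) : Set α).domRestrict (Function.update b i₀ u')) := by
      refine ⟨fun i => ?_, fun i j hij => ?_⟩
      · rcases Finset.mem_insert.1 i.2 with h | h
        · simp [Set.domRestrict_apply, h, hu'norm]
        · simp [Set.domRestrict_apply, hne _ h]
      · change inner ℂ (Function.update b i₀ u' i) (Function.update b i₀ u' j) = 0
        have hij' : (i : α) ≠ j := fun h => hij (Subtype.ext h)
        rcases Finset.mem_insert.1 i.2 with h | h <;> rcases Finset.mem_insert.1 j.2 with h' | h'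
        · exact absurd (h.trans h'.symm) hij'
        · rw [h, Function.update_self,
            Function.update_of_ne (hne _ h'), inner_eq_zero_symm]
          exact hperp _ h'
        · rw [h', Function.update_self,
            Function.update_of_ne (hne _ h)]
          exact hperp _ h
        · rw [Function.update_of_ne (hne _ h),
            Function.update_of_ne (hne _ h'), b.inner_eq_ite, if_neg hij']
    obtain ⟨b', hb'⟩ := hon.exists_orthonormalBasis_extension_of_card_eq (by simp)
    refine ⟨b', fun i hi => ?_⟩
    rw [hb' i hi]
    rcases Finset.mem_insert.1 hi with rfl | hi
    · rw [Function.update_self, ← hBapp, hu'B]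
    · rw [Function.update_of_ne (hne _ hi), hb i hi]

end Ketbra

/-! ### Algebra of operators acting on one party -/

section LocalOperators

variable {ι : Type} [Fintype ι] [DecidableEq ι]
variable {n : ι → Type} [∀ k, DecidableEq (n k)]

/-- Acting on one party, as a linear map in the local operator. -/
noncomputable def onPartyLinear (k : ι) :
    Matrix (n k) (n k) ℂ →ₗ[ℂ] Matrix (∀ k, n k) (∀ k, n k) ℂ where
  toFun := onParty k
  map_add' K K' := by
    ext i j
    simp only [onParty, Matrix.of_apply, Matrix.add_apply]
    split_ifs <;> simp
  map_smul' c K := by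
    ext i j
    simp only [onParty, Matrix.of_apply, Matrix.smul_apply, RingHom.id_apply]
    split_ifs <;> simp

theorem onPartyLinear_apply (k : ι) (K : Matrix (n k) (n k) ℂ) :
    onPartyLinear k K = onParty k K := rfl

theorem conjTranspose_onParty (k : ι) (K : Matrix (n k) (n k) ℂ) :
    (onParty k K)ᴴ = onParty k Kᴴ := by
  ext i j
  simp only [onParty, Matrix.conjTranspose_apply, Matrix.of_apply]
  by_cases h : ∀ l, l ≠ k → i l = j l
  · rw [if_pos h, if_pos fun l hl => (h l hl).symm]
  · rw [if_neg h, if_neg fun h' => h fun l hl => (h' l hl).symm, star_zero]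

variable [∀ k, Fintype (n k)]

theorem onParty_mulVec (k : ι) (K : Matrix (n k) (n k) ℂ) (ψ : (∀ k, n k) → ℂ) :
    onParty k K *ᵥ ψ = fun i => ∑ x, K (i k) x * ψ (Function.update i k x) := by
  funext i
  simp only [Matrix.mulVec, dotProduct, onParty, Matrix.of_apply, ite_mul, zero_mul]
  rw [← Finset.sum_filter]
  refine Finset.sum_nbij' (fun j => j k) (fun x => Function.update i k x) (by simp) ?_ ?_ (by simp) ?_
  · intro x _
    simp only [Finset.mem_filter, Finset.mem_univ, true_and]
    intro l hl
    rw [Function.update_of_ne hl]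
  · intro j hj
    funext l
    rcases eq_or_ne l k with rfl | hl
    · simp
    · rw [Function.update_of_ne hl, (Finset.mem_filter.1 hj).2 l hl]
  · intro j hj
    congr 2
    funext l
    rcases eq_or_ne l k with rfl | hl
    · simp
    · rw [Function.update_of_ne hl, (Finset.mem_filter.1 hj).2 l hl]

theorem onParty_mul (k : ι) (K K' : Matrix (n k) (n k) ℂ) :
    onParty k K * onParty k K' = onParty k (K * K') := by
  refine Matrix.mulVec_injective (funext fun ψ => ?_)
  rw [← Matrix.mulVec_mulVec, onParty_mulVec, onParty_mulVec, onParty_mulVec]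
  funext i
  simp only [Function.update_self, Function.update_idem, Finset.mul_sum, Matrix.mul_apply,
    Finset.sum_mul]
  rw [Finset.sum_comm]
  exact Finset.sum_congr rfl fun _ _ => Finset.sum_congr rfl fun _ _ => (mul_assoc _ _ _).symm

theorem onParty_one (k : ι) : onParty k (1 : Matrix (n k) (n k) ℂ) = 1 := by
  refine Matrix.mulVec_injective (funext fun ψ => ?_)
  rw [onParty_mulVec, Matrix.one_mulVec]
  funext i
  simp [Matrix.one_apply]

theorem onParty_mulVec_productVec (k : ι) (K : Matrix (n k) (n k) ℂ) (φ : ∀ k, n k → ℂ) :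
    onParty k K *ᵥ productVec φ = productVec (Function.update φ k (K *ᵥ φ k)) := by
  rw [onParty_mulVec]
  funext i
  simp only [productVec]
  rw [Fintype.prod_eq_mul_prod_compl k, Function.update_self]
  simp only [Matrix.mulVec, dotProduct, Finset.sum_mul]
  refine Finset.sum_congr rfl fun x _ => ?_
  rw [Fintype.prod_eq_mul_prod_compl k, Function.update_self, mul_assoc]
  congr 2
  refine Finset.prod_congr rfl fun l hl => ?_
  have hl' : l ≠ k := by simpa using hl
  rw [Function.update_of_ne hl', Function.update_of_ne hl']

end LocalOperators
-- Norms of unnormalized states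
section NormSq

variable {α : Type} [Fintype α]

/-- The squared norm of an unnormalized state. -/
noncomputable def normSq (ψ : α → ℂ) : ℝ := ∑ i, ‖ψ i‖ ^ 2

theorem star_dotProduct_self (ψ : α → ℂ) : star ψ ⬝ᵥ ψ = normSq ψ := by
  simp only [dotProduct, normSq, Pi.star_apply, Complex.star_def, Complex.conj_mul']
  push_cast
  rfl

theorem normSq_nonneg (ψ : α → ℂ) : 0 ≤ normSq ψ :=
  Finset.sum_nonneg fun _ _ => sq_nonneg _

theorem normSq_eq_zero {ψ : α → ℂ} : normSq ψ = 0 ↔ ψ = 0 := by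
  rw [normSq, Finset.sum_eq_zero_iff_of_nonneg fun _ _ => sq_nonneg _]
  simp [funext_iff]

theorem star_dotProduct_self_eq_zero {ψ : α → ℂ} : star ψ ⬝ᵥ ψ = 0 ↔ ψ = 0 := by
  rw [star_dotProduct_self, Complex.ofReal_eq_zero, normSq_eq_zero]

theorem isState_iff_normSq {ψ : α → ℂ} : IsState ψ ↔ normSq ψ = 1 := by
  rw [IsState, star_dotProduct_self, Complex.ofReal_eq_one]

theorem IsState.ne_zero {ψ : α → ℂ} (h : IsState ψ) : ψ ≠ 0 := by
  rintro rfl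
  simp [IsState] at h

theorem star_mulVec_dotProduct_mulVec [DecidableEq α] (A B : Matrix α α ℂ) (f g : α → ℂ) :
    star (A *ᵥ f) ⬝ᵥ (B *ᵥ g) = star f ⬝ᵥ ((Aᴴ * B) *ᵥ g) := by
  rw [Matrix.star_mulVec, ← Matrix.dotProduct_mulVec, Matrix.mulVec_mulVec]

theorem normSq_mulVec [DecidableEq α] {V : Matrix α α ℂ} (hV : Vᴴ * V = 1) (ψ : α → ℂ) :
    normSq (V *ᵥ ψ) = normSq ψ := by
  apply Complex.ofReal_injective
  rw [← star_dotProduct_self, ← star_dotProduct_self, star_mulVec_dotProduct_mulVec, hV,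
    Matrix.one_mulVec]

theorem exists_isState_smul {ψ : α → ℂ} (h : ψ ≠ 0) : ∃ c : ℂ, IsState (c • ψ) := by
  have hpos : 0 < normSq ψ := lt_of_le_of_ne (normSq_nonneg ψ) fun h0 => h (normSq_eq_zero.1 h0.symm)
  refine ⟨((Real.sqrt (normSq ψ))⁻¹ : ℝ), ?_⟩
  rw [IsState, star_smul, smul_dotProduct, dotProduct_smul, star_dotProduct_self, Complex.star_def,
    Complex.conj_ofReal, smul_eq_mul, smul_eq_mul, ← Complex.ofReal_mul, ← Complex.ofReal_mul,
    Complex.ofReal_eq_one, ← mul_assoc, ← mul_inv, Real.mul_self_sqrt hpos.le,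
    inv_mul_cancel₀ hpos.ne']

end NormSq

/-! ### Protocols, and discrimination of orthogonal states -/

section Protocols

variable {ι : Type} [Fintype ι] {n : ι → Type}

theorem productVec_smul (c : ι → ℂ) (φ : ∀ k, n k → ℂ) :
    productVec (fun k => c k • φ k) = (∏ k, c k) • productVec φ := by
  funext i
  simp [productVec, Finset.prod_mul_distrib]

variable [DecidableEq ι] [∀ k, Fintype (n k)]

theorem normSq_productVec (φ : ∀ k, n k → ℂ) : normSq (productVec φ) = ∏ k, normSq (φ k) := by
  simp only [normSq, productVec, norm_prod, ← Finset.prod_pow]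
  rw [Finset.prod_univ_sum, Fintype.piFinset_univ]

theorem normSq_productVec_eq_one {φ : ∀ k, n k → ℂ} (hφ : ∀ k, IsState (φ k)) :
    normSq (productVec φ) = 1 := by
  rw [normSq_productVec]
  exact Finset.prod_eq_one fun k _ => isState_iff_normSq.1 (hφ k)

theorem zero_mem_localNumericalRange_of_productVec_ne_zero {A : Matrix (∀ k, n k) (∀ k, n k) ℂ}
    {χ : ∀ k, n k → ℂ} (hχ : productVec χ ≠ 0)
    (h : star (productVec χ) ⬝ᵥ (A *ᵥ productVec χ) = 0) :
    (0 : ℂ) ∈ localNumericalRange A := by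
  have hne : ∀ k, χ k ≠ 0 := by
    intro k hk
    refine hχ (normSq_eq_zero.1 ?_)
    rw [normSq_productVec]
    exact Finset.prod_eq_zero (Finset.mem_univ k) (normSq_eq_zero.2 hk)
  choose c hc using fun k => exists_isState_smul (hne k)
  refine ⟨fun k => c k • χ k, hc, ?_⟩
  rw [productVec_smul, star_smul, smul_dotProduct, Matrix.mulVec_smul, dotProduct_smul, h,
    smul_zero, smul_zero]

variable [∀ k, DecidableEq (n k)]

/-- Completeness makes ψ ↦ (Kₛψ)ₛ an isometry, so inner products, not only norms, split over the
outcomes. -/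
theorem sum_star_onParty_dotProduct {r : ℕ} {k : ι} {K : Fin r → Matrix (n k) (n k) ℂ}
    (hK : ∑ s, (K s)ᴴ * K s = 1) (f g : (∀ k, n k) → ℂ) :
    ∑ s, star (onParty k (K s) *ᵥ f) ⬝ᵥ (onParty k (K s) *ᵥ g) = star f ⬝ᵥ g := by
  simp only [star_mulVec_dotProduct_mulVec, conjTranspose_onParty, onParty_mul]
  rw [← dotProduct_sum, ← Matrix.sum_mulVec]
  simp only [← onPartyLinear_apply]
  rw [← map_sum, hK, onPartyLinear_apply, onParty_one, Matrix.one_mulVec]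

theorem sum_normSq_onParty {r : ℕ} {k : ι} {K : Fin r → Matrix (n k) (n k) ℂ}
    (hK : ∑ s, (K s)ᴴ * K s = 1) (f : (∀ k, n k) → ℂ) :
    ∑ s, normSq (onParty k (K s) *ᵥ f) = normSq f := by
  apply Complex.ofReal_injective
  push_cast
  simp only [← star_dotProduct_self]
  exact sum_star_onParty_dotProduct hK f f

/-- With this bound on each branch, equality for the whole protocol forces equality in every branch.
-/
theorem Protocol.prob_le_normSq {V : Matrix (∀ k, n k) (∀ k, n k) ℂ} (hV : Vᴴ * V = 1) (c : Bool)
    {N : ℕ} (P : Protocol n N) (ψ : (∀ k, n k) → ℂ) : P.prob V c ψ ≤ normSq ψ := by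
  induction P generalizing ψ with
  | guess b =>
    simp only [Protocol.prob]
    split_ifs
    · exact le_rfl
    · exact normSq_nonneg ψ
  | measure k r K hK next ih =>
    rw [Protocol.prob, ← sum_normSq_onParty hK]
    exact Finset.sum_le_sum fun s _ => ih s _
  | run next ih =>
    rw [Protocol.prob, ← normSq_mulVec hV ψ]
    exact ih _

/-- A branch of a protocol whose guess is certain has a certain guess. -/
theorem Protocol.prob_next_eq_normSq {V : Matrix (∀ k, n k) (∀ k, n k) ℂ} (hV : Vᴴ * V = 1)
    {c : Bool} {N : ℕ} {k : ι} {r : ℕ} {K : Fin r → Matrix (n k) (n k) ℂ}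
    (hK : ∑ s, (K s)ᴴ * K s = 1) {next : Fin r → Protocol n N} {ψ : (∀ k, n k) → ℂ}
    (h : (Protocol.measure k r K hK next).prob V c ψ = normSq ψ) (s : Fin r) :
    (next s).prob V c (onParty k (K s) *ᵥ ψ) = normSq (onParty k (K s) *ᵥ ψ) := by
  rw [Protocol.prob, ← sum_normSq_onParty hK] at h
  exact (Finset.sum_eq_sum_iff_of_le fun s _ => Protocol.prob_le_normSq hV c (next s) _).1 h s
    (Finset.mem_univ s)

/-- States that are told apart with certainty are orthogonal. -/
theorem Protocol.orthogonal_of_prob_eq {V₁ V₂ : Matrix (∀ k, n k) (∀ k, n k) ℂ}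
    (hV₁ : V₁ᴴ * V₁ = 1) (hV₂ : V₂ᴴ * V₂ = 1) {N : ℕ} (P : Protocol n N) (hN : N = 0)
    (f g : (∀ k, n k) → ℂ) (hf : P.prob V₁ false f = normSq f)
    (hg : P.prob V₂ true g = normSq g) : star f ⬝ᵥ g = 0 := by
  induction P generalizing f g with
  | guess b =>
    cases b
    · have hg0 : g = 0 := normSq_eq_zero.1 (by simpa [Protocol.prob] using hg.symm)
      simp [hg0]
    · have hf0 : f = 0 := normSq_eq_zero.1 (by simpa [Protocol.prob] using hf.symm)
      simp [hf0]
  | measure k r K hK next ih =>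
    rw [← sum_star_onParty_dotProduct hK]
    exact Finset.sum_eq_zero fun s _ => ih s hN _ _ (Protocol.prob_next_eq_normSq hV₁ hK hf s)
      (Protocol.prob_next_eq_normSq hV₂ hK hg s)
  | run next ih => exact absurd hN (Nat.succ_ne_zero _)

/-- In a protocol with one run that identifies the operation, the unknown operations map some
nonzero product vector to orthogonal vectors. -/
theorem Protocol.exists_productVec_orthogonal {V₁ V₂ : Matrix (∀ k, n k) (∀ k, n k) ℂ}
    (hV₁ : V₁ᴴ * V₁ = 1) (hV₂ : V₂ᴴ * V₂ = 1) {N : ℕ} (P : Protocol n N) (hN : N = 1)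
    (φ : ∀ k, n k → ℂ) (hφ : productVec φ ≠ 0)
    (hf : P.prob V₁ false (productVec φ) = normSq (productVec φ))
    (hg : P.prob V₂ true (productVec φ) = normSq (productVec φ)) :
    ∃ χ : ∀ k, n k → ℂ, productVec χ ≠ 0 ∧
      star (productVec χ) ⬝ᵥ ((V₁ᴴ * V₂) *ᵥ productVec χ) = 0 := by
  induction P generalizing φ with
  | guess b => exact absurd hN.symm one_ne_zero
  | measure k r K hK next ih =>
    -- Some outcome has positive probability; following it keeps the product vector nonzero.
    obtain ⟨s, hs⟩ : ∃ s, onParty k (K s) *ᵥ productVec φ ≠ 0 := by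
      by_contra! h
      refine hφ (normSq_eq_zero.1 ?_)
      rw [← sum_normSq_onParty hK]
      exact Finset.sum_eq_zero fun s _ => normSq_eq_zero.2 (h s)
    have h₁ := Protocol.prob_next_eq_normSq hV₁ hK hf s
    have h₂ := Protocol.prob_next_eq_normSq hV₂ hK hg s
    rw [onParty_mulVec_productVec] at hs h₁ h₂
    exact ih s hN _ hs h₁ h₂
  | run next ih =>
    refine ⟨φ, hφ, ?_⟩
    rw [← star_mulVec_dotProduct_mulVec]
    refine Protocol.orthogonal_of_prob_eq hV₁ hV₂ next (Nat.succ_injective hN) _ _ ?_ ?_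
    · rw [normSq_mulVec hV₁]
      exact hf
    · rw [normSq_mulVec hV₂]
      exact hg

/-- The condition that the vectors `f` and `g` are both products of the same states of the parties
outside `S` with vectors of the parties in `S`, up to degenerate cases: in `f i * g j` the
coordinates of the parties outside `S` may be swapped. -/
def SwapOutside (S : Finset ι) (f g : (∀ k, n k) → ℂ) : Prop :=
  ∀ i j, f i * g j = f (S.piecewise i j) * g (S.piecewise j i)

/-- The projection leaves party k in the same state v in both vectors, so k joins the parties
outside S. -/
theorem SwapOutside.onParty_ketbra {S : Finset ι} {f g : (∀ k, n k) → ℂ} (h : SwapOutside S f g)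
    {k : ι} (hk : k ∈ S) (v : n k → ℂ) :
    SwapOutside (S.erase k) (onParty k (Matrix.vecMulVec v (star v)) *ᵥ f)
      (onParty k (Matrix.vecMulVec v (star v)) *ᵥ g) := by
  intro i j
  have key : ∀ (i j : ∀ k, n k) (x y : n k),
      S.piecewise (Function.update i k x) (Function.update j k y) =
        Function.update ((S.erase k).piecewise i j) k x := by
    intro i j x y
    funext l
    rcases eq_or_ne l k with rfl | hl
    · simp [hk]
    · by_cases hlS : l ∈ S <;> simp [hl, hlS]
  simp only [onParty_mulVec, Matrix.vecMulVec_apply, Finset.piecewise_eq_of_notMem _ _ _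
    (Finset.notMem_erase k S), Finset.sum_mul_sum]
  refine Finset.sum_congr rfl fun x _ => Finset.sum_congr rfl fun y _ => ?_
  have h' := h (Function.update i k x) (Function.update j k y)
  rw [key, key] at h'
  linear_combination (v (i k) * star v x * v (j k) * star v y) * h'

/-- Two orthogonal pure states are distinguished by local projective measurements of the parties
one after the other, each in a basis that may depend on the previous outcomes. -/
theorem exists_protocol_of_orthogonal (S : Finset ι) (f g : (∀ k, n k) → ℂ)
    (hS : SwapOutside S f g) (hfg : star f ⬝ᵥ g = 0) :
    ∃ P : Protocol n 0, P.IsProjective ∧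
      ∀ V, P.prob V false f = normSq f ∧ P.prob V true g = normSq g := by
  induction S using Finset.induction_on generalizing f g with
  | empty =>
    -- With no party left, f i * g j = f j * g i: the vectors are parallel and orthogonal.
    have hzero : f = 0 ∨ g = 0 := by
      by_contra! h
      obtain ⟨j, hj⟩ := Function.ne_iff.1 h.2
      refine h.1 (star_dotProduct_self_eq_zero.1 ?_)
      have : (star f ⬝ᵥ f) * g j = f j * (star f ⬝ᵥ g) := by
        simp only [dotProduct, Finset.sum_mul, Finset.mul_sum]
        refine Finset.sum_congr rfl fun i _ => ?_
        have h' := hS i j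
        simp only [Finset.piecewise_empty] at h'
        linear_combination star f i * h'
      rw [hfg, mul_zero] at this
      exact (mul_eq_zero.1 this).resolve_right hj
    rcases hzero with rfl | rfl
    · exact ⟨.guess true, trivial, fun V => by simp [Protocol.prob, normSq]⟩
    · exact ⟨.guess false, trivial, fun V => by simp [Protocol.prob, normSq]⟩
  | insert k S hk ih =>
    -- L K = ⟨f|K g⟩ vanishes at 1 by orthogonality. On a rank-one projection it is the inner
    -- product of the two states after that outcome, so a basis with zero diagonal preserves
    -- orthogonality.
    let L : Matrix (n k) (n k) ℂ →ₗ[ℂ] ℂ :=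
      { toFun := fun K => star f ⬝ᵥ (onPartyLinear k K *ᵥ g)
        map_add' := fun K K' => by rw [map_add, Matrix.add_mulVec, dotProduct_add]
        map_smul' := fun c K => by
          rw [map_smul, Matrix.smul_mulVec, dotProduct_smul, RingHom.id_apply] }
    have hL : L 1 = 0 := by
      change star f ⬝ᵥ (onParty k 1 *ᵥ g) = 0
      rw [onParty_one, Matrix.one_mulVec, hfg]
    obtain ⟨b, hb⟩ := exists_orthonormalBasis_apply_ketbra_eq_zero L hL
    let e := Fintype.equivFin (n k)
    let K : Fin (Fintype.card (n k)) → Matrix (n k) (n k) ℂ := fun s =>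
      Matrix.vecMulVec (b (e.symm s)).ofLp (star (b (e.symm s)).ofLp)
    have hproj : ∀ s, IsStarProjection (K s) := by
      intro s
      refine ⟨?_, ?_⟩
      · have h1 : star (b (e.symm s)).ofLp ⬝ᵥ (b (e.symm s)).ofLp = 1 := by
          have := inner_self_eq_one_of_norm_eq_one (𝕜 := ℂ) (b.orthonormal.1 (e.symm s))
          rwa [EuclideanSpace.inner_eq_star_dotProduct, dotProduct_comm] at this
        rw [IsIdempotentElem, Matrix.vecMulVec_mul_vecMulVec, h1, one_smul]
      · rw [IsSelfAdjoint, Matrix.star_eq_conjTranspose, Matrix.conjTranspose_vecMulVec, star_star]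
    have hKK : ∀ s, (K s)ᴴ * K s = K s := by
      intro s
      rw [← Matrix.star_eq_conjTranspose, (hproj s).isSelfAdjoint.star_eq]
      exact (hproj s).isIdempotentElem
    have hK : ∑ s, (K s)ᴴ * K s = 1 := by
      simp only [hKK]
      rw [← sum_ketbra_orthonormalBasis b]
      exact Fintype.sum_equiv e.symm _ _ fun s => rfl
    have hnext : ∀ s, ∃ P : Protocol n 0, P.IsProjective ∧ ∀ V,
        P.prob V false (onParty k (K s) *ᵥ f) = normSq (onParty k (K s) *ᵥ f) ∧
          P.prob V true (onParty k (K s) *ᵥ g) = normSq (onParty k (K s) *ᵥ g) := by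
      intro s
      refine ih _ _ ?_ ?_
      · have := hS.onParty_ketbra (Finset.mem_insert_self k S) (b (e.symm s)).ofLp
        rwa [Finset.erase_insert hk] at this
      · rw [star_mulVec_dotProduct_mulVec, conjTranspose_onParty, onParty_mul, hKK]
        exact hb _
    choose P hP hprob using hnext
    refine ⟨.measure k _ K hK P, ⟨Or.inr hproj, hP⟩, fun V => ⟨?_, ?_⟩⟩
    · rw [Protocol.prob, ← sum_normSq_onParty hK]
      exact Finset.sum_congr rfl fun s _ => (hprob s V).1
    · rw [Protocol.prob, ← sum_normSq_onParty hK]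
      exact Finset.sum_congr rfl fun s _ => (hprob s V).2

theorem exists_protocol_identifies {V₁ V₂ : Matrix (∀ k, n k) (∀ k, n k) ℂ}
    (hV₁ : V₁ᴴ * V₁ = 1) (hV₂ : V₂ᴴ * V₂ = 1)
    (h : (0 : ℂ) ∈ localNumericalRange (V₁ᴴ * V₂)) :
    ∃ (φ : ∀ k, n k → ℂ) (P : Protocol n 1),
      (∀ k, IsState (φ k)) ∧ P.IsProjective ∧ P.Identifies (productVec φ) V₁ V₂ := by
  obtain ⟨φ, hφ, h0⟩ := h
  -- For S the set of all parties, `SwapOutside` is no condition.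
  obtain ⟨P, hP, hprob⟩ := exists_protocol_of_orthogonal Finset.univ (V₁ *ᵥ productVec φ)
    (V₂ *ᵥ productVec φ) (fun i j => by simp) (by rw [star_mulVec_dotProduct_mulVec, ← h0])
  refine ⟨φ, .run P, hφ, hP, ?_, ?_⟩
  · rw [Protocol.prob, (hprob _).1, normSq_mulVec hV₁, normSq_productVec_eq_one hφ]
  · rw [Protocol.prob, (hprob _).2, normSq_mulVec hV₂, normSq_productVec_eq_one hφ]

theorem Protocol.Identifies.zero_mem_localNumericalRange
    {V₁ V₂ : Matrix (∀ k, n k) (∀ k, n k) ℂ} (hV₁ : V₁ᴴ * V₁ = 1) (hV₂ : V₂ᴴ * V₂ = 1)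
    {φ : ∀ k, n k → ℂ} (hφ : ∀ k, IsState (φ k)) {P : Protocol n 1}
    (hP : P.Identifies (productVec φ) V₁ V₂) : (0 : ℂ) ∈ localNumericalRange (V₁ᴴ * V₂) := by
  have hnorm := normSq_productVec_eq_one hφ
  obtain ⟨χ, hχ, h⟩ := P.exists_productVec_orthogonal hV₁ hV₂ rfl φ
    (fun h => by simp [normSq_eq_zero.2 h] at hnorm) (hP.1.trans hnorm.symm) (hP.2.trans hnorm.symm)
  exact zero_mem_localNumericalRange_of_productVec_ne_zero hχ h

end Protocols

/-! ### Elimination of auxiliary systems -/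

section Ancilla

variable {ι : Type} [Fintype ι] {n a : ι → Type}

theorem withAncilla_eq_submatrix [∀ k, DecidableEq (a k)] (A : Matrix (∀ k, n k) (∀ k, n k) ℂ) :
    withAncilla a A = (Matrix.kronecker A (1 : Matrix (∀ k, a k) (∀ k, a k) ℂ)).submatrix
      (Equiv.arrowProdEquivProdArrow ι n a) (Equiv.arrowProdEquivProdArrow ι n a) := by
  ext i j
  simp [withAncilla, Matrix.one_apply, funext_iff, Equiv.arrowProdEquivProdArrow]

theorem withAncilla_one [∀ k, DecidableEq (n k)] [∀ k, DecidableEq (a k)] : withAncilla a (1 : Matrix (∀ k, n k) (∀ k, n k) ℂ) = 1 := by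
  rw [withAncilla_eq_submatrix, Matrix.kronecker, Matrix.one_kronecker_one,
    Matrix.submatrix_one_equiv]

variable [DecidableEq ι] [∀ k, Fintype (n k)] [∀ k, Fintype (a k)]

theorem conjTranspose_withAncilla_mul [∀ k, DecidableEq (a k)] (A B : Matrix (∀ k, n k) (∀ k, n k) ℂ) :
    (withAncilla a A)ᴴ * withAncilla a B = withAncilla a (Aᴴ * B) := by
  simp only [withAncilla_eq_submatrix]
  rw [Matrix.conjTranspose_submatrix, Matrix.submatrix_mul_equiv, Matrix.kronecker,
    Matrix.conjTranspose_kronecker, Matrix.conjTranspose_one, ← Matrix.mul_kronecker_mul,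
    Matrix.one_mul]

/-- The expectation value `Tr (A ⨂ₖ ρₖ)`, as a multilinear map in the operators `ρₖ`. -/
noncomputable def productExpectation (A : Matrix (∀ k, n k) (∀ k, n k) ℂ) :
    MultilinearMap ℂ (fun k => Matrix (n k) (n k) ℂ) ℂ :=
  ∑ i, ∑ j, A i j • (MultilinearMap.mkPiAlgebra ℂ ι ℂ).compLinearMap
    fun k => Matrix.entryLinearMap ℂ ℂ (j k) (i k)

theorem productExpectation_apply (A : Matrix (∀ k, n k) (∀ k, n k) ℂ)
    (ρ : ∀ k, Matrix (n k) (n k) ℂ) :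
    productExpectation A ρ = ∑ i, ∑ j, A i j * ∏ k, ρ k (j k) (i k) := by
  simp [productExpectation]

theorem productExpectation_ketbra (A : Matrix (∀ k, n k) (∀ k, n k) ℂ) (φ : ∀ k, n k → ℂ) :
    productExpectation A (fun k => Matrix.vecMulVec (φ k) (star (φ k))) =
      star (productVec φ) ⬝ᵥ (A *ᵥ productVec φ) := by
  rw [productExpectation_apply]
  simp only [dotProduct, Matrix.mulVec, Finset.mul_sum, Matrix.vecMulVec_apply, productVec,
    Pi.star_apply, star_prod, Finset.prod_mul_distrib]
  refine Finset.sum_congr rfl fun i _ => Finset.sum_congr rfl fun j _ => ?_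
  ring

/-- With auxiliary systems, the expectation value is that in the product of the reduced states. -/
theorem productExpectation_reduced [∀ k, DecidableEq (a k)] (A : Matrix (∀ k, n k) (∀ k, n k) ℂ)
    (φ : ∀ k, n k × a k → ℂ) :
    productExpectation A (fun k => ∑ t, Matrix.vecMulVec (fun x => φ k (x, t))
        (star fun x => φ k (x, t))) =
      star (productVec φ) ⬝ᵥ (withAncilla a A *ᵥ productVec φ) := by
  rw [productExpectation_apply, withAncilla_eq_submatrix]
  simp only [dotProduct, Matrix.mulVec, Matrix.submatrix_apply]
  let e := Equiv.arrowProdEquivProdArrow ι n a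
  rw [← e.symm.sum_comp, Fintype.sum_prod_type]
  refine Finset.sum_congr rfl fun i _ => ?_
  have hinner : ∀ t, (∑ q, Matrix.kronecker A (1 : Matrix (∀ k, a k) (∀ k, a k) ℂ)
      (e (e.symm (i, t))) (e q) * productVec φ q) =
      ∑ j, A i j * productVec φ (e.symm (j, t)) := by
    intro t
    rw [← e.symm.sum_comp, Fintype.sum_prod_type]
    refine Finset.sum_congr rfl fun j _ => ?_
    simp [Matrix.one_apply]
  rw [Finset.sum_congr rfl fun t _ => congrArg _ (hinner t)]
  simp only [Finset.mul_sum]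
  rw [Finset.sum_comm]
  refine Finset.sum_congr rfl fun j _ => ?_
  simp only [Matrix.sum_apply, Matrix.vecMulVec_apply]
  -- The product of the local partial traces expands into one sum over joint ancilla indices t.
  rw [Finset.prod_univ_sum, Fintype.piFinset_univ, Finset.mul_sum]
  refine Finset.sum_congr rfl fun t _ => ?_
  simp only [Finset.prod_mul_distrib, productVec, Pi.star_apply, star_prod,
    e, Equiv.arrowProdEquivProdArrow, Equiv.coe_fn_symm_mk]
  ring

/-- Mixed local states give no advantage: a zero expectation value in a product of mixed states
is attained by a product of pure states. -/
theorem exists_productVec_ne_zero_of_productExpectation (A : Matrix (∀ k, n k) (∀ k, n k) ℂ)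
    (φ : ∀ k, a k → n k → ℂ) (hφ : ∀ k, φ k ≠ 0)
    (h : productExpectation A
      (fun k => ∑ t, Matrix.vecMulVec (φ k t) (star (φ k t))) = 0) :
    ∃ χ : ∀ k, n k → ℂ, (∀ k, χ k ≠ 0) ∧
      productExpectation A (fun k => Matrix.vecMulVec (χ k) (star (χ k))) = 0 := by
  suffices H : ∀ S : Finset ι, ∃ χ : ∀ k, n k → ℂ, (∀ k, χ k ≠ 0) ∧
      productExpectation A (S.piecewise (fun k => Matrix.vecMulVec (χ k) (star (χ k)))
        (fun k => ∑ t, Matrix.vecMulVec (φ k t) (star (φ k t)))) = 0 by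
    obtain ⟨χ, hχ, hS⟩ := H Finset.univ
    rw [Finset.piecewise_univ] at hS
    exact ⟨χ, hχ, hS⟩
  intro S
  induction S using Finset.induction_on with
  | empty =>
    choose t ht using fun k => Function.ne_iff.1 (hφ k)
    exact ⟨fun k => φ k (t k), ht, by rw [Finset.piecewise_empty, h]⟩
  | insert l S hl ih =>
    obtain ⟨χ, hχ, hS⟩ := ih
    set ρ := S.piecewise (fun k => Matrix.vecMulVec (χ k) (star (χ k)))
        (fun k => ∑ t, Matrix.vecMulVec (φ k t) (star (φ k t))) with hρ
    -- With the other arguments fixed, the expectation is a linear functional of ρ l, and ρ l is a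
    -- sum of ketbras; a single ketbra gives the same value.
    obtain ⟨u, -, hu, hu0⟩ := exists_apply_self_eq_sum
      (ketbraForm ((productExpectation A).toLinearMap ρ l)) ⊤ Finset.univ (φ l)
      fun _ _ => Submodule.mem_top
    have hne : u ≠ 0 := fun h0 => hφ l (funext fun t => hu0 h0 t (Finset.mem_univ t))
    refine ⟨Function.update χ l u, fun k => ?_, ?_⟩
    · rcases eq_or_ne k l with rfl | hk
      · rwa [Function.update_self]
      · rw [Function.update_of_ne hk]
        exact hχ k
    · have hρl : ρ l = ∑ t, Matrix.vecMulVec (φ l t) (star (φ l t)) := by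
        rw [hρ, Finset.piecewise_eq_of_notMem _ _ _ hl]
      simp only [ketbraForm_apply] at hu
      rw [← map_sum, ← hρl, MultilinearMap.toLinearMap_apply, MultilinearMap.toLinearMap_apply,
        Function.update_eq_self, hS] at hu
      rw [← hu]
      congr 1
      funext k
      rcases eq_or_ne k l with rfl | hk
      · simp
      · by_cases hkS : k ∈ S <;> simp [hρ, hk, hkS]

/-- Local ancillary entanglement does not help to reach the expectation value zero. -/
theorem zero_mem_localNumericalRange_of_withAncilla [∀ k, DecidableEq (a k)]
    {A : Matrix (∀ k, n k) (∀ k, n k) ℂ}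
    (h : (0 : ℂ) ∈ localNumericalRange (withAncilla a A)) : (0 : ℂ) ∈ localNumericalRange A := by
  obtain ⟨φ, hφ, h0⟩ := h
  rw [← productExpectation_reduced] at h0
  obtain ⟨χ, hχ, hA⟩ := exists_productVec_ne_zero_of_productExpectation A
    (fun k t x => φ k (x, t))
    (fun k hk => (hφ k).ne_zero (funext fun p => congrFun (congrFun hk p.2) p.1)) h0.symm
  rw [productExpectation_ketbra] at hA
  refine zero_mem_localNumericalRange_of_productVec_ne_zero (fun h => ?_) hA
  have h1 := normSq_productVec χ
  rw [normSq_eq_zero.2 h] at h1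
  obtain ⟨k, -, hk⟩ := Finset.prod_eq_zero_iff.1 h1.symm
  exact hχ k (normSq_eq_zero.1 hk)

theorem zero_mem_localNumericalRange_withAncilla [∀ k, DecidableEq (a k)] [∀ k, Unique (a k)]
    {A : Matrix (∀ k, n k) (∀ k, n k) ℂ} (h : (0 : ℂ) ∈ localNumericalRange A) :
    (0 : ℂ) ∈ localNumericalRange (withAncilla a A) := by
  obtain ⟨φ, hφ, h0⟩ := h
  refine ⟨fun k p => φ k p.1, fun k => ?_, ?_⟩
  · have := hφ k
    simpa [IsState, dotProduct, Fintype.sum_prod_type] using this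
  · rw [← productExpectation_reduced, h0, ← productExpectation_ketbra]
    simp

end Ancilla

end LOCC

/-! ### The characterization -/

theorem theorem1 {m : ℕ} {d : Fin m → ℕ}
    (U₁ U₂ : Matrix (∀ k, Fin (d k)) (∀ k, Fin (d k)) ℂ)
    (hU₁ : U₁ ∈ Matrix.unitaryGroup (∀ k, Fin (d k)) ℂ)
    (hU₂ : U₂ ∈ Matrix.unitaryGroup (∀ k, Fin (d k)) ℂ) :
    (LOCC.Distinguishable 1 U₁ U₂ ↔ (0 : ℂ) ∈ LOCC.localNumericalRange (U₁ᴴ * U₂)) ∧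
      (LOCC.Distinguishable 1 U₁ U₂ ↔ LOCC.DistinguishableWithoutAncilla 1 U₁ U₂) := by
  have h₁ : U₁ᴴ * U₁ = 1 := Matrix.mem_unitaryGroup_iff'.1 hU₁
  have h₂ : U₂ᴴ * U₂ = 1 := Matrix.mem_unitaryGroup_iff'.1 hU₂
  have ha : ∀ {a : Fin m → ℕ} {U : Matrix (∀ k, Fin (d k)) (∀ k, Fin (d k)) ℂ}, Uᴴ * U = 1 →
      (LOCC.withAncilla (fun k => Fin (a k)) U)ᴴ * LOCC.withAncilla (fun k => Fin (a k)) U = 1 := by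
    intro a U hU
    rw [LOCC.conjTranspose_withAncilla_mul, hU, LOCC.withAncilla_one]
  have hdist : LOCC.Distinguishable 1 U₁ U₂ ↔ (0 : ℂ) ∈ LOCC.localNumericalRange (U₁ᴴ * U₂) := by
    constructor
    · rintro ⟨a, φ, P, hφ, hP⟩
      have h := hP.zero_mem_localNumericalRange (ha h₁) (ha h₂) hφ
      rw [LOCC.conjTranspose_withAncilla_mul] at h
      exact LOCC.zero_mem_localNumericalRange_of_withAncilla h
    · intro h
      -- One-dimensional auxiliary systems suffice.
      have h' := LOCC.zero_mem_localNumericalRange_withAncilla (a := fun _ => Fin 1) h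
      rw [← LOCC.conjTranspose_withAncilla_mul] at h'
      obtain ⟨φ, P, hφ, -, hP⟩ := LOCC.exists_protocol_identifies
        (ha (a := fun _ => 1) h₁) (ha (a := fun _ => 1) h₂) h'
      exact ⟨fun _ => 1, φ, P, hφ, hP⟩
  refine ⟨hdist, hdist.trans ⟨LOCC.exists_protocol_identifies h₁ h₂, ?_⟩⟩
  rintro ⟨φ, P, hφ, -, hP⟩
  exact hP.zero_mem_localNumericalRange h₁ h₂ hφ
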